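/- For a group $G$, the power graph $\mathcal P(G)$ is the simple graph with vertex set $G$ in which two distinct elements are adjacent iff one of them is a power of the other, and the enhanced power graph $\mathcal P_e(G)$ is the simple graph with vertex set $G$ in which two distinct elements $x,y$ are adjacent iff the subgroup $\langle x,y\rangle$ is cyclic. The difference graph $\mathcal D(G)$ is obtained from the graph on $G$ whose edges are the edges of $\mathcal P_e(G)$ that are not edges of $\mathcal P(G)$ by removing all isolated vertices. **Theorem 3.12.** Let $G$ and $K$ be finite abelian groups such that each of $|G|$ and $|K|$ has exactly two prime divisors (equivalently, each group has exactly two nontrivial Sylow subgroups; the primes for $G$ and $K$ are not assumed to coincide). If $\mathcal D(G)$ and $\mathcal D(K)$ are isomorphic as graphs, then $G$ and $K$ are isomorphic as groups. -/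

import Mathlib

/-- The power graph of a group: distinct elements are adjacent iff one is a power of the other. -/
def powerGraph (G : Type*) [Group G] : SimpleGraph G where
  Adj x y := x ≠ y ∧ (x ∈ Subgroup.zpowers y ∨ y ∈ Subgroup.zpowers x)
  symm := ⟨fun _ _ h => ⟨h.1.symm, h.2.symm⟩⟩
  loopless := ⟨fun _ h => h.1 rfl⟩

/-- The enhanced power graph of a group: distinct elements are adjacent iff the subgroup
generated by the two of them is cyclic. -/
def enhancedPowerGraph (G : Type*) [Group G] : SimpleGraph G where
  Adj x y := x ≠ y ∧ IsCyclic (Subgroup.closure {x, y})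
  symm := ⟨fun x y h => ⟨h.1.symm, by rw [Set.pair_comm]; exact h.2⟩⟩
  loopless := ⟨fun _ h => h.1 rfl⟩

/-- The edge difference of the enhanced power graph and the power graph, on all of `G`. -/
def fullDifferenceGraph (G : Type*) [Group G] : SimpleGraph G :=
  enhancedPowerGraph G \ powerGraph G

/-- The difference graph of a group: the enhanced power graph minus the power graph, with the
isolated vertices removed (`support` is the set of vertices that have a neighbour). -/
def differenceGraph (G : Type*) [Group G] : SimpleGraph (fullDifferenceGraph G).support :=
  (fullDifferenceGraph G).induce (fullDifferenceGraph G).support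

set_option linter.unusedSectionVars false

open Subgroup

/-! Write `G ≃* P × Q` as the product of its Sylow subgroups. Cyclic subgroups inside a cyclic
p-group form a chain, so two pairs are adjacent exactly when one coordinate strictly increases and
the other strictly decreases in the order of generated cyclic subgroups
(`fullDifferenceGraph_prod_adj`). An isomorphism of difference graphs thus gives two such labellings
of a single graph, and the task is to recover the factors from adjacency alone.

A vertex of maximal degree has a trivial coordinate (`eq_one_of_maximal_degree`); up to swapping
factors it is `w = (a, 1)`. From `w`, the set of all vertices `(1, y)` is cut out by neighbourhood
inclusion and divisibility of degrees (`divisorCore_eq`), and the vertices `(x, 1)` are those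
adjacent to all of that set (`snd_eq_one_iff`). Counting them gives `|P|` and `|Q|`, hence the
primes. The degree of `(x, 1)` is `(orderOf x / p) * (|Q| - 1)`, so degrees reveal element orders,
and these determine a finite abelian p-group (`IsPGroup.nonempty_mulEquiv_of_card_pow_eq_one`). -/

/-- The elements generating a proper subgroup of the cyclic subgroup generated by `a`. -/
def cyclicBelow {P : Type*} [Group P] (a : P) : Set P := {x | zpowers x < zpowers a}

/-- The elements generating a cyclic subgroup that properly contains the one generated by `a`. -/
def cyclicAbove {P : Type*} [Group P] (a : P) : Set P := {x | zpowers a < zpowers x}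

theorem cyclicBelow_one {P : Type*} [Group P] : cyclicBelow (1 : P) = ∅ := by
  ext x
  simp [cyclicBelow, zpowers_one_eq_bot]

theorem cyclicAbove_one {P : Type*} [Group P] : cyclicAbove (1 : P) = {x | x ≠ 1} := by
  ext x
  simp [cyclicAbove, zpowers_one_eq_bot, bot_lt_iff_ne_bot]

theorem zpowers_pow_eq_of_coprime {G : Type*} [Group G] {s : G} {n : ℕ}
    (h : n.Coprime (orderOf s)) : zpowers (s ^ n) = zpowers s :=
  le_antisymm (zpowers_le.2 (pow_mem (mem_zpowers s) n))
    (zpowers_le.2 (mem_zpowers_pow_iff.2 h))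

theorem IsPGroup.coprime_orderOf {p : ℕ} [Fact p.Prime] {P : Type*} [Group P] (hP : IsPGroup p P) (s : P) {n : ℕ} (h : ¬ p ∣ n) :
    n.Coprime (orderOf s) := by
  obtain ⟨k, hk⟩ := IsPGroup.iff_orderOf.1 hP s
  rw [hk]
  exact Nat.Coprime.pow_right _ (((Fact.out : p.Prime).coprime_iff_not_dvd.2 h).symm)

theorem ncard_ne_one_set (P : Type*) [Group P] [Finite P] :
    {x : P | x ≠ 1}.ncard = Nat.card P - 1 := by
  have : {x : P | x ≠ 1} = {(1 : P)}ᶜ := rfl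
  rw [this, Set.ncard_compl, Set.ncard_singleton]

/-! ### Cyclic subgroups of p-groups -/

section PGroup

variable {p : ℕ} [Fact p.Prime] {P : Type*} [Group P] [Finite P]

theorem IsPGroup.exists_zpowers_eq_zpowers_pow (hP : IsPGroup p P) {s a : P}
    (ha : a ∈ zpowers s) : ∃ i : ℕ, zpowers a = zpowers (s ^ p ^ i) := by
  have hs : 0 < orderOf s := orderOf_pos s
  obtain ⟨m, rfl⟩ := mem_powers_iff_mem_zpowers.2 ha
  -- Adding the order leaves the power of `s` unchanged and makes the exponent nonzero, so that its
  -- p-part can be split off.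
  have hm : m + orderOf s ≠ 0 := by omega
  obtain ⟨i, u, hu, hmu⟩ := Nat.exists_eq_pow_mul_and_not_dvd hm p (Fact.out : p.Prime).ne_one
  refine ⟨i, ?_⟩
  have : s ^ m = (s ^ p ^ i) ^ u := by
    rw [← pow_mul, ← hmu, pow_add, pow_orderOf_eq_one, mul_one]
  change zpowers (s ^ m) = _
  rw [this]
  exact zpowers_pow_eq_of_coprime (hP.coprime_orderOf _ hu)

theorem IsPGroup.zpowers_le_total (hP : IsPGroup p P) {s a b : P}
    (ha : a ∈ zpowers s) (hb : b ∈ zpowers s) :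
    zpowers a ≤ zpowers b ∨ zpowers b ≤ zpowers a := by
  obtain ⟨i, hi⟩ := hP.exists_zpowers_eq_zpowers_pow ha
  obtain ⟨j, hj⟩ := hP.exists_zpowers_eq_zpowers_pow hb
  rw [hi, hj]
  have key : ∀ {i j : ℕ}, i ≤ j → zpowers (s ^ p ^ j) ≤ zpowers (s ^ p ^ i) := by
    intro i j hij
    obtain ⟨k, rfl⟩ := Nat.exists_eq_add_of_le hij
    rw [zpowers_le, pow_add, pow_mul]
    exact pow_mem (mem_zpowers _) _
  rcases le_total i j with h | h
  · exact Or.inr (key h)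
  · exact Or.inl (key h)

theorem IsPGroup.cyclicBelow_eq (hP : IsPGroup p P) {a : P} (ha : a ≠ 1) :
    cyclicBelow a = (zpowers (a ^ p) : Set P) := by
  ext x
  constructor
  · intro hx
    obtain ⟨m, rfl⟩ := mem_powers_iff_mem_zpowers.2 (zpowers_le.1 (le_of_lt hx))
    by_cases hm : p ∣ m
    · obtain ⟨k, rfl⟩ := hm
      simp only [pow_mul]
      exact pow_mem (mem_zpowers _) _
    · exact absurd (zpowers_pow_eq_of_coprime (hP.coprime_orderOf a hm)) (ne_of_lt hx)
  · intro hx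
    have h1 : zpowers x ≤ zpowers (a ^ p) := zpowers_le.2 hx
    refine lt_of_le_of_lt h1 (lt_of_le_of_ne (zpowers_le.2 (pow_mem (mem_zpowers _) _)) ?_)
    intro h
    have h2 : a ∈ zpowers (a ^ p) := h ▸ mem_zpowers a
    exact (Fact.out : p.Prime).coprime_iff_not_dvd.1 (mem_zpowers_pow_iff.1 h2)
      (hP.dvd_orderOf ha)

theorem IsPGroup.mul_ncard_cyclicBelow (hP : IsPGroup p P) {a : P} (ha : a ≠ 1) :
    p * (cyclicBelow a).ncard = orderOf a := by
  rw [hP.cyclicBelow_eq ha, ← Nat.card_coe_set_eq]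
  change p * Nat.card (zpowers (a ^ p)) = _
  rw [Nat.card_zpowers]
  rw [orderOf_pow, Nat.gcd_eq_right (hP.dvd_orderOf ha)]
  exact Nat.mul_div_cancel' (hP.dvd_orderOf ha)

/-- The p-group `zpowers b` acts on this set by translation without fixed points. The action is well
defined because `b` is a power of `x ^ p`, so a translate of `x` is a power of `x` with exponent 1
mod p and generates the same subgroup. -/
theorem IsPGroup.dvd_ncard_cyclicAbove (hP : IsPGroup p P) {b : P} (hb : b ≠ 1) :
    p ∣ (cyclicAbove b).ncard := by
  have key : ∀ x ∈ cyclicAbove b, ∀ c ∈ zpowers b, zpowers (c * x) = zpowers x := by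
    intro x hx c hc
    have hx' : b ∈ cyclicBelow x := hx
    have hx1 : x ≠ 1 := by
      rintro rfl
      simp [cyclicBelow_one] at hx'
    rw [hP.cyclicBelow_eq hx1] at hx'
    obtain ⟨m, rfl⟩ := mem_powers_iff_mem_zpowers.2 (zpowers_le.2 hx' hc)
    have : (x ^ p) ^ m * x = x ^ (p * m + 1) := by rw [pow_succ, pow_mul]
    change zpowers ((x ^ p) ^ m * x) = _
    rw [this]
    refine zpowers_pow_eq_of_coprime (hP.coprime_orderOf x ?_)
    rw [← Nat.dvd_add_iff_right (dvd_mul_right p m)]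
    exact (Fact.out : p.Prime).not_dvd_one
  let act : MulAction (zpowers b) (cyclicAbove b) :=
    { smul := fun c x => ⟨c.1 * x.1, by
        have := key x.1 x.2 c.1 c.2
        have hx := x.2
        simp only [cyclicAbove, Set.mem_ofPred_eq] at hx ⊢
        rwa [this]⟩
      one_smul := fun x => Subtype.ext (one_mul x.1)
      mul_smul := fun c d x => Subtype.ext (mul_assoc c.1 d.1 x.1) }
  have h := (hP.to_subgroup (zpowers b)).card_modEq_card_fixedPoints (cyclicAbove b)
  have h0 : IsEmpty (MulAction.fixedPoints (zpowers b) (cyclicAbove b)) := by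
    refine ⟨fun x => hb ?_⟩
    have h1 := x.2 ⟨b, mem_zpowers b⟩
    have h2 : b * x.1.1 = x.1.1 := congrArg Subtype.val h1
    simpa using h2
  rw [Nat.card_coe_set_eq, @Nat.card_of_isEmpty _ h0] at h
  exact (Nat.modEq_zero_iff_dvd).1 h

end PGroup

/-! ### Finite abelian p-groups are determined by their numbers of solutions of `x ^ d = 1` -/

section StructureTheorem

theorem card_pow_eq_one_pi_zmod {ι : Type*} [Fintype ι] (n : ι → ℕ) (hn : ∀ i, n i ≠ 0) (d : ℕ) :
    Nat.card {x : (i : ι) → Multiplicative (ZMod (n i)) // x ^ d = 1} =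
      ∏ i, (n i).gcd d := by
  have e : {x : (i : ι) → Multiplicative (ZMod (n i)) // x ^ d = 1} ≃
      ((i : ι) → (powMonoidHom d : Multiplicative (ZMod (n i)) →* _).ker) :=
    (Equiv.subtypeEquivRight fun x => by
      simp only [funext_iff, Pi.pow_apply, Pi.one_apply, MonoidHom.mem_ker, powMonoidHom_apply]).trans
      (Equiv.subtypePiEquivPi
        (p := fun i (a : Multiplicative (ZMod (n i))) => a ∈ (powMonoidHom d : _ →* _).ker))
  rw [Nat.card_congr e, Nat.card_pi]
  refine Finset.prod_congr rfl fun i _ => ?_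
  have : NeZero (n i) := ⟨hn i⟩
  rw [IsCyclic.card_powMonoidHom_ker]
  congr 1
  exact Nat.card_zmod (n i)

theorem sum_min_succ {ι : Type*} [Fintype ι] (g : ι → ℕ) (k : ℕ) :
    ∑ i, min (g i) (k + 1) = ∑ i, min (g i) k + ∑ i, if k < g i then 1 else 0 := by
  rw [← Finset.sum_add_distrib]
  refine Finset.sum_congr rfl fun i _ => ?_
  split_ifs <;> omega

theorem sum_lt_eq_add {ι : Type*} [Fintype ι] (g : ι → ℕ) (k : ℕ) :
    (∑ i, if k < g i then 1 else 0) =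
      (∑ i, if k + 1 < g i then 1 else 0) + ∑ i, if g i = k + 1 then 1 else 0 := by
  rw [← Finset.sum_add_distrib]
  refine Finset.sum_congr rfl fun i _ => ?_
  split_ifs <;> omega

/-- First differences in `k` count the indices with value above `k`; second differences count those
with value exactly `k + 1`. The value 0 is invisible to these sums, whence the positivity
hypotheses. -/
theorem card_fiber_eq_of_sum_min_eq {ι κ : Type*} [Fintype ι] [Fintype κ] {e : ι → ℕ} {f : κ → ℕ}
    (he : ∀ i, 0 < e i) (hf : ∀ j, 0 < f j)
    (h : ∀ k, ∑ i, min (e i) k = ∑ j, min (f j) k) (m : ℕ) :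
    Fintype.card {i // e i = m} = Fintype.card {j // f j = m} := by
  have hlt : ∀ k, (∑ i, if k < e i then 1 else 0) = ∑ j, if k < f j then 1 else 0 := by
    intro k
    have h1 := h (k + 1)
    rw [sum_min_succ e, sum_min_succ f, h k] at h1
    omega
  rw [Fintype.card_subtype, Fintype.card_subtype, Finset.card_filter, Finset.card_filter]
  cases m with
  | zero =>
    rw [Finset.sum_eq_zero, Finset.sum_eq_zero]
    · intro j _
      rw [if_neg (hf j).ne']
    · intro i _
      rw [if_neg (he i).ne']
  | succ k =>
    have h1 := hlt k
    rw [sum_lt_eq_add e, sum_lt_eq_add f, hlt (k + 1)] at h1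
    omega

theorem IsPGroup.exists_mulEquiv_pi_zmod {p : ℕ} [Fact p.Prime] {P : Type*} [CommGroup P] [Finite P]
    (hP : IsPGroup p P) :
    ∃ (ι : Type) (_ : Fintype ι) (e : ι → ℕ), (∀ i, 0 < e i) ∧
      Nonempty (P ≃* ((i : ι) → Multiplicative (ZMod (p ^ e i)))) := by
  obtain ⟨ι, inst, n, hn, ⟨φ⟩⟩ := CommGroup.equiv_prod_multiplicative_zmod_of_finite P
  classical
  have key : ∀ i, ∃ k, 0 < k ∧ n i = p ^ k := by
    intro i
    have : NeZero (n i) := ⟨(zero_lt_one.trans (hn i)).ne'⟩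
    have hf : IsPGroup p (Multiplicative (ZMod (n i))) :=
      hP.of_surjective ((Pi.evalMonoidHom _ i).comp φ.toMonoidHom)
        ((Function.surjective_eval i).comp φ.surjective)
    obtain ⟨k, hk⟩ := IsPGroup.iff_card.1 hf
    have hk' : n i = p ^ k := by
      rw [← hk]; exact (Nat.card_zmod (n i)).symm
    refine ⟨k, Nat.pos_of_ne_zero ?_, hk'⟩
    rintro rfl
    have h1 := hn i
    rw [hk', pow_zero] at h1
    exact lt_irrefl _ h1
  choose e he0 he using key
  obtain rfl : n = fun i => p ^ e i := funext he
  exact ⟨ι, inst, e, he0, ⟨φ⟩⟩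

theorem card_pow_prime_pow_eq_one {p : ℕ} [Fact p.Prime] {X : Type*} [CommGroup X] {ι : Type*}
    [Fintype ι] (g : ι → ℕ) (χ : X ≃* ((i : ι) → Multiplicative (ZMod (p ^ g i)))) (k : ℕ) :
    Nat.card {x : X // x ^ p ^ k = 1} = p ^ ∑ i, min (g i) k := by
  have e : {x : X // x ^ p ^ k = 1} ≃
      {x : (i : ι) → Multiplicative (ZMod (p ^ g i)) // x ^ p ^ k = 1} :=
    χ.toEquiv.subtypeEquiv fun x => by
      change _ ↔ (χ x) ^ p ^ k = 1
      rw [← map_pow, map_eq_one_iff χ χ.injective]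
  rw [Nat.card_congr e,
    card_pow_eq_one_pi_zmod _ (fun i => pow_ne_zero _ (Fact.out : p.Prime).ne_zero),
    ← Finset.prod_pow_eq_pow_sum]
  refine Finset.prod_congr rfl fun i _ => ?_
  rcases le_total (g i) k with hle | hle
  · rw [min_eq_left hle, Nat.gcd_eq_left (pow_dvd_pow p hle)]
  · rw [min_eq_right hle, Nat.gcd_eq_right (pow_dvd_pow p hle)]

theorem IsPGroup.nonempty_mulEquiv_of_card_pow_eq_one {p : ℕ} [Fact p.Prime] {P R : Type*}
    [CommGroup P] [Finite P] [CommGroup R] [Finite R] (hP : IsPGroup p P) (hR : IsPGroup p R)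
    (h : ∀ d : ℕ, Nat.card {x : P // x ^ d = 1} = Nat.card {x : R // x ^ d = 1}) :
    Nonempty (P ≃* R) := by
  obtain ⟨ι, _, e, he, ⟨φ⟩⟩ := hP.exists_mulEquiv_pi_zmod
  obtain ⟨κ, _, f, hf, ⟨ψ⟩⟩ := hR.exists_mulEquiv_pi_zmod
  have hp : p.Prime := Fact.out
  have hsum : ∀ k, ∑ i, min (e i) k = ∑ j, min (f j) k := by
    intro k
    have h1 := h (p ^ k)
    rw [card_pow_prime_pow_eq_one e φ, card_pow_prime_pow_eq_one f ψ] at h1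
    exact Nat.pow_right_injective hp.two_le h1
  let σ : ι ≃ κ := Equiv.ofFiberEquiv (f := e) (g := f) fun m =>
    Fintype.equivOfCardEq (card_fiber_eq_of_sum_min_eq he hf hsum m)
  have hσ : ∀ i, f (σ i) = e i := fun i => Equiv.ofFiberEquiv_map _ i
  let χ : ((i : ι) → Multiplicative (ZMod (p ^ e i))) ≃*
      ((j : κ) → Multiplicative (ZMod (p ^ f j))) :=
    (MulEquiv.piCongrRight fun i => (ZMod.ringEquivCongr (by rw [hσ])).toAddEquiv.toMultiplicative :
        _ ≃* ((i : ι) → Multiplicative (ZMod (p ^ f (σ i))))).trans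
    { Equiv.piCongrLeft (fun j => Multiplicative (ZMod (p ^ f j))) σ with
      map_mul' := fun x y => by
        funext j
        obtain ⟨i, rfl⟩ := σ.surjective j
        simp [Equiv.piCongrLeft_apply_apply] }
  exact ⟨φ.trans (χ.trans ψ.symm)⟩

end StructureTheorem

/-! ### Adjacency in a product of a p-group and a q-group -/

section Product

variable {p q : ℕ} [Fact p.Prime] [Fact q.Prime] {P Q : Type*} [CommGroup P] [CommGroup Q]
  [Finite P] [Finite Q]

theorem mem_zpowers_prod_iff (hP : IsPGroup p P) (hQ : IsPGroup q Q) (hpq : p ≠ q)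
    {z w : P × Q} : z ∈ zpowers w ↔ z.1 ∈ zpowers w.1 ∧ z.2 ∈ zpowers w.2 := by
  constructor
  · rintro ⟨n, rfl⟩
    exact ⟨⟨n, rfl⟩, ⟨n, rfl⟩⟩
  · rintro ⟨h1, h2⟩
    obtain ⟨m, hm⟩ := mem_powers_iff_mem_zpowers.2 h1
    obtain ⟨n, hn⟩ := mem_powers_iff_mem_zpowers.2 h2
    have hco : (orderOf w.1).Coprime (orderOf w.2) := by
      obtain ⟨k, hk⟩ := IsPGroup.iff_orderOf.1 hP w.1
      obtain ⟨l, hl⟩ := IsPGroup.iff_orderOf.1 hQ w.2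
      rw [hk, hl]
      exact Nat.coprime_pow_primes k l Fact.out Fact.out hpq
    obtain ⟨k, hk1, hk2⟩ := Nat.chineseRemainder hco m n
    refine mem_powers_iff_mem_zpowers.1 ⟨k, Prod.ext ?_ ?_⟩
    · exact (pow_eq_pow_iff_modEq.2 hk1).trans hm
    · exact (pow_eq_pow_iff_modEq.2 hk2).trans hn

/-- The relation that the first components strictly increase and the second components strictly
decrease, or conversely, where elements are compared by the cyclic subgroups they generate. -/
def CyclicCrossed {P Q : Type*} [Group P] [Group Q] (z w : P × Q) : Prop :=
  (z.1 ∈ cyclicBelow w.1 ∧ w.2 ∈ cyclicBelow z.2) ∨ (w.1 ∈ cyclicBelow z.1 ∧ z.2 ∈ cyclicBelow w.2)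

theorem CyclicCrossed.symm {P Q : Type*} [Group P] [Group Q] {z w : P × Q}
    (h : CyclicCrossed z w) : CyclicCrossed w z := Or.symm h

theorem CyclicCrossed.swap {P Q : Type*} [Group P] [Group Q] {z w : P × Q}
    (h : CyclicCrossed z w) : CyclicCrossed z.swap w.swap :=
  (Or.imp And.symm And.symm h).symm

theorem isCyclic_closure_of_mem {G : Type*} [Group G] {x y z : G}
    (hx : x ∈ zpowers z) (hy : y ∈ zpowers z) : IsCyclic (closure {x, y}) := by
  have hle : closure {x, y} ≤ zpowers z := by
    rw [closure_le]
    rintro u (rfl | rfl)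
    · exact hx
    · exact hy
  have : IsCyclic ((closure {x, y}).subgroupOf (zpowers z)) := inferInstance
  exact (subgroupOfEquivOfLe hle).isCyclic.1 this

theorem isCyclic_closure_prod_iff (hP : IsPGroup p P) (hQ : IsPGroup q Q) (hpq : p ≠ q)
    (z w : P × Q) : IsCyclic (closure {z, w}) ↔
      (z.1 ∈ zpowers w.1 ∨ w.1 ∈ zpowers z.1) ∧ (z.2 ∈ zpowers w.2 ∨ w.2 ∈ zpowers z.2) := by
  constructor
  · intro h
    obtain ⟨g, hg⟩ := isCyclic_iff_exists_zpowers_eq_top.1 h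
    have hmem : ∀ u ∈ closure {z, w}, u ∈ zpowers (g : P × Q) := by
      intro u hu
      obtain ⟨n, hn⟩ : (⟨u, hu⟩ : closure {z, w}) ∈ zpowers g := hg ▸ mem_top _
      exact ⟨n, congrArg Subtype.val hn⟩
    have hz := (mem_zpowers_prod_iff hP hQ hpq).1 (hmem z (subset_closure (by simp)))
    have hw := (mem_zpowers_prod_iff hP hQ hpq).1 (hmem w (subset_closure (by simp)))
    simp only [← zpowers_le]
    exact ⟨hP.zpowers_le_total hz.1 hw.1, hQ.zpowers_le_total hz.2 hw.2⟩
  · rintro ⟨h1, h2⟩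
    obtain ⟨s, hs1, hs2⟩ : ∃ s : P, z.1 ∈ zpowers s ∧ w.1 ∈ zpowers s := by
      rcases h1 with h | h
      · exact ⟨_, h, mem_zpowers _⟩
      · exact ⟨_, mem_zpowers _, h⟩
    obtain ⟨t, ht1, ht2⟩ : ∃ t : Q, z.2 ∈ zpowers t ∧ w.2 ∈ zpowers t := by
      rcases h2 with h | h
      · exact ⟨_, h, mem_zpowers _⟩
      · exact ⟨_, mem_zpowers _, h⟩
    exact isCyclic_closure_of_mem (z := (s, t)) ((mem_zpowers_prod_iff hP hQ hpq).2 ⟨hs1, ht1⟩)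
      ((mem_zpowers_prod_iff hP hQ hpq).2 ⟨hs2, ht2⟩)

theorem ne_one_of_mem_cyclicBelow {G : Type*} [Group G] {x y : G} (h : x ∈ cyclicBelow y) :
    y ≠ 1 := by
  rintro rfl
  rwa [cyclicBelow_one] at h

theorem one_mem_cyclicBelow_iff {G : Type*} [Group G] {x : G} : 1 ∈ cyclicBelow x ↔ x ≠ 1 := by
  change x ∈ cyclicAbove 1 ↔ _
  rw [cyclicAbove_one]
  rfl

theorem mem_cyclicBelow_iff {G : Type*} [Group G] {x y : G} :
    x ∈ cyclicBelow y ↔ x ∈ zpowers y ∧ y ∉ zpowers x := by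
  simp only [cyclicBelow, Set.mem_ofPred_eq, lt_iff_le_not_ge, zpowers_le]

/-- An enhanced edge means comparability in each coordinate; a power edge means comparability in
both in the same direction. Only strictly opposite directions remain. -/
theorem fullDifferenceGraph_prod_adj (hP : IsPGroup p P) (hQ : IsPGroup q Q) (hpq : p ≠ q)
    (z w : P × Q) : (fullDifferenceGraph (P × Q)).Adj z w ↔ CyclicCrossed z w := by
  have hne : z = w → z.1 ∈ zpowers w.1 ∧ z.2 ∈ zpowers w.2 := by
    rintro rfl
    exact ⟨mem_zpowers _, mem_zpowers _⟩
  simp only [fullDifferenceGraph, SimpleGraph.sdiff_adj, enhancedPowerGraph, powerGraph,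
    isCyclic_closure_prod_iff hP hQ hpq, mem_zpowers_prod_iff hP hQ hpq, CyclicCrossed,
    mem_cyclicBelow_iff, ne_eq]
  tauto

theorem fullDifferenceGraph_adj_map {G H : Type*} [Group G] [Group H] (φ : G ≃* H) (x y : G) :
    (fullDifferenceGraph H).Adj (φ x) (φ y) ↔ (fullDifferenceGraph G).Adj x y := by
  have hz : ∀ x y : G, φ x ∈ zpowers (φ y) ↔ x ∈ zpowers y := by
    intro x y
    rw [← MulEquiv.coe_toMonoidHom, ← MonoidHom.map_zpowers, MulEquiv.coe_toMonoidHom]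
    exact mem_map_iff_mem (f := φ.toMonoidHom) φ.injective
  have hc : IsCyclic (closure {φ x, φ y}) ↔ IsCyclic (closure {x, y}) := by
    have : closure {φ x, φ y} = (closure {x, y}).map φ.toMonoidHom := by
      rw [MonoidHom.map_closure, Set.image_pair]
      rfl
    rw [this]
    exact (MulEquiv.isCyclic ((closure {x, y}).equivMapOfInjective φ.toMonoidHom φ.injective)).symm
  simp only [fullDifferenceGraph, SimpleGraph.sdiff_adj, enhancedPowerGraph, powerGraph, hz, hc,
    ne_eq, φ.injective.eq_iff]

theorem IsPGroup.two_mul_ncard_cyclicBelow_le (hP : IsPGroup p P) {a a' : P} (ha : a ∈ cyclicBelow a')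
    (ha1 : a ≠ 1) : 2 * (cyclicBelow a).ncard ≤ (cyclicBelow a').ncard := by
  have h1 := hP.mul_ncard_cyclicBelow ha1
  have h2 : (zpowers a : Set P) ⊆ cyclicBelow a' := fun x hx =>
    lt_of_le_of_lt (zpowers_le.2 hx) ha
  have h3 := Set.ncard_le_ncard h2
  rw [← Nat.card_coe_set_eq] at h3
  change Nat.card (zpowers a) ≤ _ at h3
  rw [Nat.card_zpowers, ← h1] at h3
  exact (Nat.mul_le_mul_right _ (Fact.out : p.Prime).two_le).trans h3

theorem ncard_cyclicAbove_lt {a : P} (ha : a ≠ 1) : (cyclicAbove a).ncard < Nat.card P - 1 := by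
  rw [← ncard_ne_one_set]
  refine Set.ncard_lt_ncard ⟨fun x hx hx1 => ?_, fun H => ?_⟩
  · have : a ∈ cyclicBelow x := hx
    rw [hx1, cyclicBelow_one] at this
    exact this
  · exact lt_irrefl (zpowers a) (H ha)

theorem cyclicBelow_ncard_pos {a : P} (ha : a ≠ 1) : 0 < (cyclicBelow a).ncard := by
  rw [Set.ncard_pos]
  exact ⟨1, one_mem_cyclicBelow_iff.2 ha⟩

theorem IsPGroup.exists_cyclicBelow_eq_singleton [Nontrivial P] (hP : IsPGroup p P) :
    ∃ x : P, x ≠ 1 ∧ cyclicBelow x = {1} := by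
  have hpd : p ∣ Nat.card P := by
    obtain ⟨x, hx⟩ := exists_ne (1 : P)
    exact (hP.dvd_orderOf hx).trans (orderOf_dvd_natCard x)
  obtain ⟨x, hx⟩ := exists_prime_orderOf_dvd_card' p hpd
  have hx1 : x ≠ 1 := by
    rintro rfl
    rw [orderOf_one] at hx
    exact (Fact.out : p.Prime).ne_one hx.symm
  refine ⟨x, hx1, ?_⟩
  rw [hP.cyclicBelow_eq hx1, ← hx, pow_orderOf_eq_one, zpowers_one_eq_bot, coe_bot]

end Product

/-! ### Recovering the factors from a labelled graph -/

/-- Labels of the vertices of a graph by pairs, under which adjacency is `CyclicCrossed` and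
exactly the nonisolated pairs are used. -/
structure IsCrossedLabelling {V P Q : Type*} [Group P] [Group Q] (D : SimpleGraph V)
    (π : V → P × Q) : Prop where
  injective : Function.Injective π
  adj_iff : ∀ u v, D.Adj u v ↔ CyclicCrossed (π u) (π v)
  mem_range : ∀ z w, CyclicCrossed z w → z ∈ Set.range π
  exists_adj : ∀ v, ∃ u, D.Adj v u

/-- The vertices adjacent to all `v` whose neighbourhood is contained in that of `w`, with cardinality dividing the degree of `w`. -/
def SimpleGraph.divisorCore {V : Type*} (D : SimpleGraph V) (w : V) : Set V :=
  {u | ∀ v, D.neighborSet v ⊆ D.neighborSet w →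
    (D.neighborSet v).ncard ∣ (D.neighborSet w).ncard → D.Adj v u}

namespace IsCrossedLabelling

variable {p q : ℕ} [Fact p.Prime] [Fact q.Prime] {V P Q : Type*} [CommGroup P] [CommGroup Q]
  {D : SimpleGraph V} {π : V → P × Q}

theorem swap (h : IsCrossedLabelling D π) : IsCrossedLabelling D (fun v => (π v).swap) where
  injective := Prod.swap_injective.comp h.injective
  adj_iff u v := (h.adj_iff u v).trans ⟨fun H => H.swap, fun H => H.swap⟩
  mem_range z w H := by
    obtain ⟨v, hv⟩ := h.mem_range z.swap w.swap H.swap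
    exact ⟨v, by simp [hv]⟩
  exists_adj := h.exists_adj

theorem image_neighborSet (h : IsCrossedLabelling D π) (v : V) :
    π '' D.neighborSet v = cyclicBelow (π v).1 ×ˢ cyclicAbove (π v).2 ∪
      cyclicAbove (π v).1 ×ˢ cyclicBelow (π v).2 := by
  ext z
  have hz : z ∈ cyclicBelow (π v).1 ×ˢ cyclicAbove (π v).2 ∪
      cyclicAbove (π v).1 ×ˢ cyclicBelow (π v).2 ↔ CyclicCrossed z (π v) := Iff.rfl
  rw [hz]
  constructor
  · rintro ⟨u, hu, rfl⟩
    exact (h.adj_iff u v).1 hu.symm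
  · intro H
    obtain ⟨u, rfl⟩ := h.mem_range _ _ H
    exact ⟨u, ((h.adj_iff u v).2 H).symm, rfl⟩

theorem exists_label_left [Nontrivial Q] (h : IsCrossedLabelling D π) {a : P} (ha : a ≠ 1) :
    ∃ v, π v = (a, 1) := by
  obtain ⟨y, hy⟩ := exists_ne (1 : Q)
  refine h.mem_range (a, 1) (1, y) (Or.inr ⟨?_, ?_⟩)
  · exact one_mem_cyclicBelow_iff.2 ha
  · exact one_mem_cyclicBelow_iff.2 hy

theorem exists_label_right [Nontrivial P] (h : IsCrossedLabelling D π) {b : Q} (hb : b ≠ 1) :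
    ∃ v, π v = (1, b) := by
  obtain ⟨v, hv⟩ := h.swap.exists_label_left hb
  exact ⟨v, Prod.swap_injective hv⟩

theorem ne_one_of_snd_eq_one (h : IsCrossedLabelling D π) {v : V} (h1 : (π v).2 = 1) :
    (π v).1 ≠ 1 := by
  intro h2
  obtain ⟨u, hu⟩ := h.exists_adj v
  rcases (h.adj_iff v u).1 hu with H | H
  · exact ne_one_of_mem_cyclicBelow H.2 h1
  · exact ne_one_of_mem_cyclicBelow H.1 h2

theorem comp_iso {W : Type*} {E : SimpleGraph W} (h : IsCrossedLabelling D π) (f : E ≃g D) :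
    IsCrossedLabelling E (π ∘ f) where
  injective := h.injective.comp f.injective
  adj_iff u v := f.map_adj_iff.symm.trans (h.adj_iff _ _)
  mem_range z w H := by
    obtain ⟨v, hv⟩ := h.mem_range z w H
    exact ⟨f.symm v, by simp [hv]⟩
  exists_adj v := by
    obtain ⟨u, hu⟩ := h.exists_adj (f v)
    exact ⟨f.symm u, f.map_adj_iff.1 (by simpa using hu)⟩

variable [Finite P] [Finite Q]

theorem ncard_neighborSet (h : IsCrossedLabelling D π) (v : V) :
    (D.neighborSet v).ncard = (cyclicBelow (π v).1).ncard * (cyclicAbove (π v).2).ncard +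
      (cyclicAbove (π v).1).ncard * (cyclicBelow (π v).2).ncard := by
  rw [← Set.ncard_image_of_injective _ h.injective, h.image_neighborSet, Set.ncard_union_eq,
    Set.ncard_prod, Set.ncard_prod]
  rw [Set.disjoint_left]
  rintro z ⟨h1, _⟩ ⟨h2, _⟩
  exact lt_asymm (show zpowers z.1 < zpowers (π v).1 from h1) h2

theorem ncard_neighborSet_left (h : IsCrossedLabelling D π) {v : V} (hv : (π v).2 = 1) :
    (D.neighborSet v).ncard = (cyclicBelow (π v).1).ncard * (Nat.card Q - 1) := by
  rw [h.ncard_neighborSet, hv, cyclicBelow_one, cyclicAbove_one, ncard_ne_one_set]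
  simp

theorem ncard_neighborSet_right (h : IsCrossedLabelling D π) {v : V} (hv : (π v).1 = 1) :
    (D.neighborSet v).ncard = (cyclicBelow (π v).2).ncard * (Nat.card P - 1) :=
  h.swap.ncard_neighborSet_left hv

/-- Suppose `w = (a, b)` with both coordinates nontrivial. If nothing lies above `a`, then `(a, 1)`
has larger degree; symmetrically for `b`. Otherwise take `a'` above `a` and `b'` above `b`: passing
up at least doubles the number of elements below, so the degrees of `(a', 1)` and `(1, b')` add up
to more than twice that of `w`. -/
theorem eq_one_of_maximal_degree [Nontrivial P] [Nontrivial Q] (h : IsCrossedLabelling D π)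
    (hP : IsPGroup p P) (hQ : IsPGroup q Q) {w : V}
    (hw : ∀ v, (D.neighborSet v).ncard ≤ (D.neighborSet w).ncard) :
    (π w).1 = 1 ∨ (π w).2 = 1 := by
  by_contra! H
  obtain ⟨ha, hb⟩ := H
  set a := (π w).1
  set b := (π w).2
  have hdeg : (D.neighborSet w).ncard = (cyclicBelow a).ncard * (cyclicAbove b).ncard +
      (cyclicAbove a).ncard * (cyclicBelow b).ncard := h.ncard_neighborSet w
  have hA := cyclicBelow_ncard_pos ha
  have hB := cyclicBelow_ncard_pos hb
  have uA := ncard_cyclicAbove_lt ha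
  have uB := ncard_cyclicAbove_lt hb
  have left : ∀ x : P, x ≠ 1 →
      (cyclicBelow x).ncard * (Nat.card Q - 1) ≤ (D.neighborSet w).ncard := by
    intro x hx
    obtain ⟨v, hv⟩ := h.exists_label_left hx
    have := hw v
    rwa [h.ncard_neighborSet_left (by rw [hv]), hv] at this
  have right : ∀ y : Q, y ≠ 1 →
      (cyclicBelow y).ncard * (Nat.card P - 1) ≤ (D.neighborSet w).ncard := by
    intro y hy
    obtain ⟨v, hv⟩ := h.exists_label_right hy
    have := hw v
    rwa [h.ncard_neighborSet_right (by rw [hv]), hv] at this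
  rw [hdeg] at left right
  rcases (cyclicAbove a).eq_empty_or_nonempty with ha0 | ⟨a', ha'⟩
  · have h1 := left a ha
    rw [ha0, Set.ncard_empty, zero_mul, add_zero] at h1
    exact absurd (Nat.le_of_mul_le_mul_left h1 hA) (not_le.2 uB)
  rcases (cyclicAbove b).eq_empty_or_nonempty with hb0 | ⟨b', hb'⟩
  · have h1 := right b hb
    rw [hb0, Set.ncard_empty, mul_zero, zero_add, mul_comm] at h1
    exact absurd (Nat.le_of_mul_le_mul_right h1 hB) (not_le.2 uA)
  have h1 := left a' (ne_one_of_mem_cyclicBelow ha')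
  have h2 := right b' (ne_one_of_mem_cyclicBelow hb')
  have h3 := hP.two_mul_ncard_cyclicBelow_le ha' ha
  have h4 := hQ.two_mul_ncard_cyclicBelow_le hb' hb
  have h5 := (Nat.mul_le_mul_right (Nat.card Q - 1) h3).trans h1
  have h6 := (Nat.mul_le_mul_right (Nat.card P - 1) h4).trans h2
  have h7 := Nat.mul_lt_mul_of_pos_left uB hA
  have h8 := Nat.mul_lt_mul_of_pos_left uA hB
  nlinarith

/-- The vertices `v` tested by the core all have the form `(x, 1)`, and every `(1, y)` is adjacent
to those. Conversely, `(x, 1)` with `x` of order p is tested, and its neighbours all have trivial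
first coordinate. -/
theorem divisorCore_eq [Nontrivial P] [Nontrivial Q] (h : IsCrossedLabelling D π)
    (hP : IsPGroup p P) (hQ : IsPGroup q Q) (hpq : p ≠ q) {w : V} (hw : (π w).2 = 1) :
    D.divisorCore w = {u | (π u).1 = 1} := by
  have hp : p.Prime := Fact.out
  have hq : q.Prime := Fact.out
  have ha : (π w).1 ≠ 1 := h.ne_one_of_snd_eq_one hw
  ext u
  constructor
  · intro hu
    obtain ⟨x, hx1, hbelow⟩ := hP.exists_cyclicBelow_eq_singleton
    obtain ⟨v, hv⟩ := h.exists_label_left hx1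
    have hadj : D.Adj v u := by
      refine hu v ?_ ?_
      · intro u' hu'
        rcases (h.adj_iff v u').1 hu' with H | H
        · rw [hv] at H
          exact absurd rfl (ne_one_of_mem_cyclicBelow H.2)
        · rw [hv, hbelow] at H
          refine (h.adj_iff w u').2 (Or.inr ⟨?_, ?_⟩)
          · rw [show (π u').1 = 1 from H.1]
            exact one_mem_cyclicBelow_iff.2 ha
          · rw [hw]
            exact H.2
      · rw [h.ncard_neighborSet_left hw, h.ncard_neighborSet_left (by rw [hv]), hv, hbelow,
          Set.ncard_singleton, one_mul]
        exact dvd_mul_left _ _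
    rcases (h.adj_iff v u).1 hadj with H | H
    · rw [hv] at H
      exact absurd rfl (ne_one_of_mem_cyclicBelow H.2)
    · rw [hv, hbelow] at H
      exact H.1
  · intro hu v hsub hdvd
    -- Otherwise `(x', 1)` would be a neighbour of `v`, while neighbours of `w` have nontrivial
    -- second coordinate.
    have hno : ∀ x' ∈ cyclicAbove (π v).1, (π v).2 = 1 := by
      intro x' hx'
      by_contra hne
      have H : CyclicCrossed (x', 1) (π v) := Or.inr ⟨hx', one_mem_cyclicBelow_iff.2 hne⟩
      obtain ⟨u', hu'⟩ := h.mem_range _ _ H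
      rw [← hu'] at H
      rcases (h.adj_iff w u').1 (hsub ((h.adj_iff v u').2 H.symm)) with H' | H'
      · exact ne_one_of_mem_cyclicBelow H'.2 hw
      · rw [hu'] at H'
        exact ne_one_of_mem_cyclicBelow H'.2 rfl
    have hv2 : (π v).2 = 1 := by
      by_contra hne
      have hempty : cyclicAbove (π v).1 = ∅ :=
        Set.eq_empty_iff_forall_notMem.2 fun x' hx' => hne (hno x' hx')
      -- Divisibility of degrees now forces a contradiction: q divides the degree of `v`, but the
      -- degree of `w` is a power of p times `|Q| - 1`, which is prime to q.
      have h1 : q ∣ (D.neighborSet w).ncard := by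
        refine dvd_trans ?_ hdvd
        rw [h.ncard_neighborSet, hempty, Set.ncard_empty, zero_mul, add_zero]
        exact (hQ.dvd_ncard_cyclicAbove hne).mul_left _
      rw [h.ncard_neighborSet_left hw] at h1
      rcases hq.dvd_mul.1 h1 with h2 | h2
      · obtain ⟨k, hk⟩ := IsPGroup.iff_orderOf.1 hP (π w).1
        rw [← hP.mul_ncard_cyclicBelow ha] at hk
        have h3 : q ∣ p ^ k := hk ▸ h2.mul_left p
        exact hpq ((Nat.prime_dvd_prime_iff_eq hq hp).1 (hq.dvd_of_dvd_pow h3)).symm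
      · have h3 : q ∣ Nat.card Q := (hQ.dvd_orderOf hne).trans (orderOf_dvd_natCard _)
        have h4 := Nat.dvd_sub h3 h2
        rw [Nat.sub_sub_self Nat.card_pos] at h4
        exact hq.one_lt.ne' (Nat.dvd_one.1 h4)
    refine (h.adj_iff v u).2 (Or.inr ⟨?_, ?_⟩)
    · rw [show (π u).1 = 1 from hu]
      exact one_mem_cyclicBelow_iff.2 (h.ne_one_of_snd_eq_one hv2)
    · rw [hv2]
      exact one_mem_cyclicBelow_iff.2 (h.swap.ne_one_of_snd_eq_one hu)

theorem snd_eq_one_iff [Nontrivial P] [Nontrivial Q] (h : IsCrossedLabelling D π) (hQ : IsPGroup q Q)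
    (v : V) : (π v).2 = 1 ↔ ∀ u ∈ {u | (π u).1 = 1}, D.Adj v u := by
  constructor
  · intro hv u hu
    refine (h.adj_iff v u).2 (Or.inr ⟨?_, ?_⟩)
    · rw [show (π u).1 = 1 from hu]
      exact one_mem_cyclicBelow_iff.2 (h.ne_one_of_snd_eq_one hv)
    · rw [hv]
      exact one_mem_cyclicBelow_iff.2 (h.swap.ne_one_of_snd_eq_one hu)
  · intro hv
    obtain ⟨y, hy, hbelow⟩ := hQ.exists_cyclicBelow_eq_singleton
    obtain ⟨u, hu⟩ := h.exists_label_right hy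
    rcases (h.adj_iff v u).1 (hv u (by simp [hu])) with H | H
    · rw [hu] at H
      exact absurd rfl (ne_one_of_mem_cyclicBelow H.1)
    · rw [hu, hbelow] at H
      exact H.2

theorem card_pow_eq_one [Nontrivial Q] (h : IsCrossedLabelling D π) (d : ℕ) :
    Nat.card {x : P // x ^ d = 1} = {v | (π v).2 = 1 ∧ orderOf (π v).1 ∣ d}.ncard + 1 := by
  have hset : {x : P | x ^ d = 1} =
      insert 1 ((fun v => (π v).1) '' {v | (π v).2 = 1 ∧ orderOf (π v).1 ∣ d}) := by
    ext x
    constructor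
    · intro hx
      by_cases hx1 : x = 1
      · exact Or.inl hx1
      · obtain ⟨v, hv⟩ := h.exists_label_left hx1
        refine Or.inr ⟨v, ⟨by rw [hv], ?_⟩, by simp only [hv]⟩
        rw [hv]
        exact orderOf_dvd_of_pow_eq_one hx
    · rintro (rfl | ⟨v, hv, rfl⟩)
      · exact one_pow d
      · exact orderOf_dvd_iff_pow_eq_one.1 hv.2
  change Nat.card ({x : P | x ^ d = 1} : Set P) = _
  rw [Nat.card_coe_set_eq, hset, Set.ncard_insert_of_notMem, Set.InjOn.ncard_image]
  · intro u hu v hv huv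
    exact h.injective (Prod.ext huv (hu.1.trans hv.1.symm))
  · rintro ⟨v, hv, hv1⟩
    exact h.ne_one_of_snd_eq_one hv.1 hv1

theorem card_fst [Nontrivial Q] (h : IsCrossedLabelling D π) :
    Nat.card P = {v | (π v).2 = 1}.ncard + 1 := by
  -- The exponent 0 imposes no condition, so all of `P` is counted.
  have := h.card_pow_eq_one 0
  simpa using this

end IsCrossedLabelling

/-! ### Comparing two labellings of one graph -/

theorem IsPGroup.prime_eq_of_card_eq {p q : ℕ} [Fact p.Prime] [Fact q.Prime] {P R : Type*} [Group P]
    [Finite P] [Nontrivial P] [Group R] [Finite R] (hP : IsPGroup p P) (hR : IsPGroup q R)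
    (h : Nat.card P = Nat.card R) : p = q := by
  obtain ⟨x, hx⟩ := exists_ne (1 : P)
  have h1 : p ∣ Nat.card R := h ▸ (hP.dvd_orderOf hx).trans (orderOf_dvd_natCard x)
  obtain ⟨n, hn⟩ := IsPGroup.iff_card.1 hR
  rw [hn] at h1
  exact (Nat.prime_dvd_prime_iff_eq Fact.out Fact.out).1
    ((Fact.out : p.Prime).dvd_of_dvd_pow h1)

namespace IsCrossedLabelling

variable {p q p' q' : ℕ} [Fact p.Prime] [Fact q.Prime] [Fact p'.Prime] [Fact q'.Prime]
  {V P Q P' Q' : Type*} [CommGroup P] [CommGroup Q] [CommGroup P'] [CommGroup Q']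
  [Finite P] [Finite Q] [Finite P'] [Finite Q']
  [Nontrivial P] [Nontrivial Q] [Nontrivial P'] [Nontrivial Q']
  {D : SimpleGraph V} {π : V → P × Q} {π' : V → P' × Q'}

theorem nonempty_mulEquiv_fst (h : IsCrossedLabelling D π) (h' : IsCrossedLabelling D π')
    (hP : IsPGroup p P) (hP' : IsPGroup p' P') (hQ : Nat.card Q = Nat.card Q')
    (hA : ∀ v, (π v).2 = 1 ↔ (π' v).2 = 1) : Nonempty (P ≃* P') := by
  have hcard : Nat.card P = Nat.card P' := by
    rw [h.card_fst, h'.card_fst]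
    simp only [hA]
  obtain rfl := hP.prime_eq_of_card_eq hP' hcard
  refine hP.nonempty_mulEquiv_of_card_pow_eq_one hP' fun d => ?_
  rw [h.card_pow_eq_one, h'.card_pow_eq_one]
  congr 2
  ext v
  refine (and_congr_left fun _ => hA v).trans (and_congr_right fun hv' => ?_)
  have hv := (hA v).2 hv'
  -- The degree of `v`, computed in both labellings, identifies the two orders after cancelling `|Q|
  -- - 1`.
  have h1 := h.ncard_neighborSet_left hv
  rw [h'.ncard_neighborSet_left hv', ← hQ] at h1
  have hpos : 0 < Nat.card Q - 1 := Nat.sub_pos_of_lt Finite.one_lt_card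
  rw [← hP.mul_ncard_cyclicBelow (h.ne_one_of_snd_eq_one hv),
    ← hP'.mul_ncard_cyclicBelow (h'.ne_one_of_snd_eq_one hv'), Nat.eq_of_mul_eq_mul_right hpos h1]

theorem nonempty_mulEquiv_of_snd_eq_one (h : IsCrossedLabelling D π)
    (h' : IsCrossedLabelling D π') (hP : IsPGroup p P) (hQ : IsPGroup q Q) (hP' : IsPGroup p' P')
    (hQ' : IsPGroup q' Q') (hpq : p ≠ q) (hpq' : p' ≠ q') {w : V} (hw : (π w).2 = 1)
    (hw' : (π' w).2 = 1) : Nonempty (P × Q ≃* P' × Q') := by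
  have hB : {u | (π u).1 = 1} = {u | (π' u).1 = 1} :=
    (h.divisorCore_eq hP hQ hpq hw).symm.trans (h'.divisorCore_eq hP' hQ' hpq' hw')
  have hB' : ∀ v, (π v).1 = 1 ↔ (π' v).1 = 1 := fun v => Set.ext_iff.1 hB v
  have hA : ∀ v, (π v).2 = 1 ↔ (π' v).2 = 1 := by
    intro v
    rw [h.snd_eq_one_iff hQ, h'.snd_eq_one_iff hQ', hB]
  have cP : Nat.card P = Nat.card P' := by
    rw [h.card_fst, h'.card_fst]
    simp only [hA]
  have cQ : Nat.card Q = Nat.card Q' := by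
    rw [h.swap.card_fst, h'.swap.card_fst]
    simp only [Prod.snd_swap, hB']
  obtain ⟨φ⟩ := h.nonempty_mulEquiv_fst h' hP hP' cQ hA
  obtain ⟨ψ⟩ := h.swap.nonempty_mulEquiv_fst h'.swap hQ hQ' cP hB'
  exact ⟨φ.prodCongr ψ⟩

theorem nonempty_mulEquiv [Finite V] [Nonempty V] (h : IsCrossedLabelling D π)
    (h' : IsCrossedLabelling D π') (hP : IsPGroup p P) (hQ : IsPGroup q Q) (hP' : IsPGroup p' P')
    (hQ' : IsPGroup q' Q') (hpq : p ≠ q) (hpq' : p' ≠ q') : Nonempty (P × Q ≃* P' × Q') := by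
  obtain ⟨w, hw⟩ := Finite.exists_max fun v => (D.neighborSet v).ncard
  -- The labellings may disagree about which coordinate of `w` is trivial; swapping factors reduces
  -- every case to the second one.
  rcases h.eq_one_of_maximal_degree hP hQ hw with hw1 | hw1 <;>
    rcases h'.eq_one_of_maximal_degree hP' hQ' hw with hw2 | hw2
  · obtain ⟨φ⟩ := h.swap.nonempty_mulEquiv_of_snd_eq_one h'.swap hQ hP hQ' hP' hpq.symm hpq'.symm
      hw1 hw2
    exact ⟨MulEquiv.prodComm.trans (φ.trans MulEquiv.prodComm)⟩
  · obtain ⟨φ⟩ := h.swap.nonempty_mulEquiv_of_snd_eq_one h' hQ hP hP' hQ' hpq.symm hpq' hw1 hw2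
    exact ⟨MulEquiv.prodComm.trans φ⟩
  · obtain ⟨φ⟩ := h.nonempty_mulEquiv_of_snd_eq_one h'.swap hP hQ hQ' hP' hpq hpq'.symm hw1 hw2
    exact ⟨φ.trans MulEquiv.prodComm⟩
  · exact h.nonempty_mulEquiv_of_snd_eq_one h' hP hQ hP' hQ' hpq hpq' hw1 hw2

end IsCrossedLabelling

/-! ### Sylow decomposition and conclusion -/

theorem isCrossedLabelling_differenceGraph {p q : ℕ} [Fact p.Prime] [Fact q.Prime]
    {G P Q : Type*} [Group G] [CommGroup P] [CommGroup Q] [Finite P] [Finite Q]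
    (hP : IsPGroup p P) (hQ : IsPGroup q Q) (hpq : p ≠ q) (φ : G ≃* P × Q) :
    IsCrossedLabelling (differenceGraph G) (fun v => φ v.1) := by
  have hadj : ∀ x y : G, (fullDifferenceGraph G).Adj x y ↔ CyclicCrossed (φ x) (φ y) :=
    fun x y => (fullDifferenceGraph_adj_map φ x y).symm.trans
      (fullDifferenceGraph_prod_adj hP hQ hpq _ _)
  refine ⟨φ.injective.comp Subtype.val_injective, fun u v => hadj u.1 v.1, fun z w H => ?_, ?_⟩
  · have H' : (fullDifferenceGraph G).Adj (φ.symm z) (φ.symm w) := by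
      rw [hadj]
      simpa using H
    exact ⟨⟨φ.symm z, ⟨_, H'⟩⟩, by simp⟩
  · rintro ⟨x, y, hy⟩
    exact ⟨⟨y, x, (fullDifferenceGraph G).adj_symm hy⟩, hy⟩

theorem exists_mulEquiv_prod_of_card_primeFactors_eq_two {G : Type*} [CommGroup G] [Finite G]
    (hG : (Nat.card G).primeFactors.card = 2) :
    ∃ (p q : ℕ) (_ : Fact p.Prime) (_ : Fact q.Prime) (P Q : Subgroup G),
      p ≠ q ∧ IsPGroup p P ∧ IsPGroup q Q ∧ Nontrivial P ∧ Nontrivial Q ∧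
        Nonempty (G ≃* P × Q) := by
  obtain ⟨p, q, hpq, hpf⟩ := Finset.card_eq_two.1 hG
  have hpm : p ∈ (Nat.card G).primeFactors := by simp [hpf]
  have hqm : q ∈ (Nat.card G).primeFactors := by simp [hpf]
  have hp : Fact p.Prime := ⟨Nat.prime_of_mem_primeFactors hpm⟩
  have hq : Fact q.Prime := ⟨Nat.prime_of_mem_primeFactors hqm⟩
  obtain ⟨P⟩ : Nonempty (Sylow p G) := inferInstance
  obtain ⟨Q⟩ : Nonempty (Sylow q G) := inferInstance
  have cP := P.card_eq_multiplicity
  have cQ := Q.card_eq_multiplicity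
  have hcard : Nat.card G = Nat.card P * Nat.card Q := by
    rw [cP, cQ]
    conv_lhs => rw [← Nat.prod_factorization_pow_eq_self (n := Nat.card G) Nat.card_pos.ne']
    rw [Finsupp.prod, Nat.support_factorization, hpf, Finset.prod_pair hpq]
  have hco : (Nat.card P).Coprime (Nat.card Q) := by
    rw [cP, cQ]
    exact Nat.coprime_pow_primes _ _ hp.out hq.out hpq
  have hinj : Function.Injective ((P : Subgroup G).subtype.coprod (Q : Subgroup G).subtype) := by
    rw [injective_iff_map_eq_one]
    rintro ⟨x, y⟩ hxy
    have hxy' : (x : G) * y = 1 := hxy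
    have hdisj := (Subgroup.disjoint_of_coprime_natCard hco).eq_bot
    have hxQ : (x : G) ∈ (Q : Subgroup G) := by
      rw [eq_inv_of_mul_eq_one_left hxy']
      exact inv_mem y.2
    have hx : (x : G) = 1 := by
      rw [← mem_bot, ← hdisj]
      exact ⟨x.2, hxQ⟩
    have hy : (y : G) = 1 := by simpa [hx] using hxy'
    exact Prod.ext (Subtype.ext hx) (Subtype.ext hy)
  have hbij := (Nat.bijective_iff_injective_and_card _).2
    ⟨hinj, by rw [Nat.card_prod]; exact hcard.symm⟩
  have nontriv : ∀ {r : ℕ} [Fact r.Prime] (S : Sylow r G), r ∈ (Nat.card G).primeFactors →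
      Nontrivial S := fun {r} _ S hr => by
    have h1 := S.dvd_card_of_dvd_card (Nat.dvd_of_mem_primeFactors hr)
    rw [← Finite.one_lt_card_iff_nontrivial]
    exact lt_of_lt_of_le (Fact.out : r.Prime).one_lt (Nat.le_of_dvd Nat.card_pos h1)
  exact ⟨p, q, hp, hq, P, Q, hpq, P.isPGroup', Q.isPGroup', nontriv P hpm, nontriv Q hqm,
    ⟨(MulEquiv.ofBijective _ hbij).symm⟩⟩

theorem theorem3p12 {G : Type*} {K : Type*} [CommGroup G] [Finite G] [CommGroup K] [Finite K]
    (hG : (Nat.card G).primeFactors.card = 2) (hK : (Nat.card K).primeFactors.card = 2)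
    (h : Nonempty (differenceGraph G ≃g differenceGraph K)) :
    Nonempty (G ≃* K) := by
  obtain ⟨f⟩ := h
  obtain ⟨p, q, _, _, P, Q, hpq, hP, hQ, _, _, ⟨φ⟩⟩ :=
    exists_mulEquiv_prod_of_card_primeFactors_eq_two hG
  obtain ⟨p', q', _, _, P', Q', hpq', hP', hQ', _, _, ⟨ψ⟩⟩ :=
    exists_mulEquiv_prod_of_card_primeFactors_eq_two hK
  have hπ := isCrossedLabelling_differenceGraph hP hQ hpq φ
  have hπ' := (isCrossedLabelling_differenceGraph hP' hQ' hpq' ψ).comp_iso f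
  obtain ⟨x, hx⟩ := exists_ne (1 : P)
  have : Nonempty (fullDifferenceGraph G).support := ⟨(hπ.exists_label_left hx).choose⟩
  obtain ⟨χ⟩ := hπ.nonempty_mulEquiv hπ' hP hQ hP' hQ' hpq hpq'
  exact ⟨φ.trans (χ.trans ψ.symm)⟩
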